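/- Let $G$ be a connected finite-dimensional real Lie group with Lie algebra $\mathfrak g$. Let $h\in\mathfrak g$ be an Euler element, i.e. $\operatorname{ad}h\neq 0$ is diagonalizable with eigenvalues in $\{-1,0,1\}$. Suppose that the involution $e^{\pi i\operatorname{ad}h}$ of $\mathfrak g$ integrates to an involutive automorphism $\tau_h$ of the Lie group $G$, and put $G_{\tau_h}=G\rtimes\{\mathrm{id}_G,\tau_h\}$. Let $(U,\mathcal H)$ be an antiunitary representation of $G_{\tau_h}$ on a complex Hilbert space, i.e. a strongly continuous homomorphism into the group of unitary or antiunitary operators on $\mathcal H$ for which $U(g)$ is unitary for all $g\in G$ and $U(\tau_h)$ is antiunitary. Let $\mathtt V=\mathtt V(h,U)\subseteq\mathcal H$ be the standard subspace with modular objects $\Delta_{\mathtt V}=e^{2\pi i\,\partial U(h)}$ and $J_{\mathtt V}=U(\tau_h)$, i.e. $\mathtt V=\operatorname{Fix}(J_{\mathtt V}\Delta_{\mathtt V}^{1/2})$ with $\Delta_{\mathtt V}^{1/2}=e^{\pi i\,\partial U(h)}$, where $\partial U(h)$ is the infinitesimal generator of the unitary one-parameter group $t\mapsto U(\exp th)$.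 Let $H\subseteq G$ be a closed subgroup, $M=G/H$, and let $W\subseteq M$ be a non-empty open subset with $\exp(th)W=W$ for all $t\in\mathbb R$. For open subsets $\mathcal O\subseteq M$ put \[ \mathsf H_M^{\max}(\mathcal O)=\bigcap_{g\in G,\ \mathcal O\subseteq gW}U(g)\mathtt V,\qquad \mathsf H_M^{\min}(\mathcal O)=\overline{\sum_{g\in G,\ gW\subseteq\mathcal O}U(g)\mathtt V}, \] where the empty intersection is $\mathcal H$ and the empty sum is $\{0\}$. A closed real subspace $\mathsf K\subseteq\mathcal H$ is called cyclic if $\mathsf K+i\mathsf K$ is dense in $\mathcal H$, separating if $\mathsf K\cap i\mathsf K=\{0\}$, and standard if it is both. Put $S_W=\{g\in G: gW\subseteq W\}$ and $S_{\mathtt V}=\{g\in G: U(g)\mathtt V\subseteq\mathtt V\}$. Then the following assertions hold. (a) Both nets $\mathsf N=\mathsf H_M^{\max}$ and $\mathsf N=\mathsf H_M^{\min}$ satisfy (Iso): $\mathsf N(\mathcal O_1)\subseteq\mathsf N(\mathcal O_2)$ for all open $\mathcal O_1\subseteq\mathcal O_2\subseteq M$, and (Cov): $U(g)\mathsf N(\mathcal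 O)=\mathsf N(g\mathcal O)$ for all $g\in G$ and all open $\mathcal O\subseteq M$. (b) The set of all open subsets $\mathcal O\subseteq M$ for which $\mathsf H_M^{\max}(\mathcal O)$ is cyclic is $G$-invariant. (c) The following are equivalent: (i) $S_W\subseteq S_{\mathtt V}$; (ii) $\mathsf H_M^{\max}(W)=\mathtt V$; (iii) $\mathsf H_M^{\max}(W)$ is standard; (iv) $\mathsf H_M^{\max}(W)$ is cyclic; (v) $\mathsf H_M^{\min}(W)=\mathtt V$; (vi) $\mathsf H_M^{\min}(W)$ is standard; (vii) $\mathsf H_M^{\min}(W)$ is separating. -/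

import Mathlib

open scoped Manifold ContDiff Pointwise
open TopologicalSpace

/-! ### Lie groups: exponential curves, Euler elements, Euler involutions -/

section LieGroups

/-- A smooth real Lie group has the (lower) smoothness under which Mathlib equips its tangent space
at the identity with the Lie bracket. -/
instance lieGroup_minSmoothness
    {E : Type*} [NormedAddCommGroup E] [NormedSpace ℝ E]
    {G : Type*} [TopologicalSpace G] [ChartedSpace E G] [Group G] [LieGroup 𝓘(ℝ, E) ∞ G] :
    LieGroup 𝓘(ℝ, E) (minSmoothness ℝ 3) G := by
  rw [minSmoothness_of_isRCLikeNormedField]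
  infer_instance

variable {E : Type*} [NormedAddCommGroup E] [NormedSpace ℝ E] [FiniteDimensional ℝ E]
  {G : Type*} [TopologicalSpace G] [ChartedSpace E G] [Group G] [LieGroup 𝓘(ℝ, E) ∞ G]

/-- Left-invariant vector fields are complete: there is an integral curve through `1` that is
defined for all times. -/
theorem exists_expCurve [T2Space G] (x : GroupLieAlgebra 𝓘(ℝ, E) G) :
    ∃ γ : ℝ → G, γ 0 = 1 ∧ IsMIntegralCurve γ (mulInvariantVectorField (I := 𝓘(ℝ, E)) x) := by
  have hsm : minSmoothness ℝ 2 = 2 := minSmoothness_of_isRCLikeNormedField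
  have : IsManifold 𝓘(ℝ, E) ∞ G := (inferInstance : LieGroup 𝓘(ℝ, E) ∞ G).toIsManifold
  have : IsManifold 𝓘(ℝ, E) 1 G := IsManifold.of_le (n := ∞) (by exact_mod_cast le_top)
  have hv : ContMDiff 𝓘(ℝ, E) 𝓘(ℝ, E).tangent 1
      (fun g : G ↦ (⟨g, mulInvariantVectorField x g⟩ : TangentBundle 𝓘(ℝ, E) G)) := by
    refine (contMDiff_mulInvariantVectorField x).of_le ?_
    rw [hsm]; exact_mod_cast one_le_two
  have : CompleteSpace E := FiniteDimensional.complete ℝ E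
  obtain ⟨γ, h0, hγ⟩ := exists_isMIntegralCurveAt_of_contMDiffAt_boundaryless 0
    (hv.contMDiffAt (x := 1))
  obtain ⟨ε, hε, hγ⟩ := isMIntegralCurveAt_iff'.1 hγ
  refine exists_isMIntegralCurve_of_isMIntegralCurveOn hv hε (fun g ↦ ?_) 1
  refine ⟨fun t ↦ g * γ t, by simp [h0], ?_⟩
  intro t ht
  have h1 := hγ t (by rwa [Real.ball_eq_Ioo, zero_sub, zero_add])
  rw [Real.ball_eq_Ioo, zero_sub, zero_add] at h1
  have hd : ∀ a b : G, MDifferentiableAt 𝓘(ℝ, E) 𝓘(ℝ, E) (fun c : G ↦ a * c) b := fun a b ↦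
    (contMDiff_mul_left (n := ∞)).mdifferentiableAt (by simp)
  have key : mulInvariantVectorField (I := 𝓘(ℝ, E)) x (g * γ t) =
      mfderiv 𝓘(ℝ, E) 𝓘(ℝ, E) (fun c : G ↦ g * c) (γ t) (mulInvariantVectorField x (γ t)) := by
    have hcomp : (fun c : G ↦ g * γ t * c) = (fun c : G ↦ g * c) ∘ (fun c : G ↦ γ t * c) := by
      ext c; simp [mul_assoc]
    have h3 : mfderiv 𝓘(ℝ, E) 𝓘(ℝ, E) (fun c : G ↦ g * γ t * c) 1 x =
        mfderiv 𝓘(ℝ, E) 𝓘(ℝ, E) (fun c : G ↦ g * c) (γ t * 1)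
          (mfderiv 𝓘(ℝ, E) 𝓘(ℝ, E) (fun c : G ↦ γ t * c) 1 x) := by
      have := mfderiv_comp (I' := 𝓘(ℝ, E)) (1 : G) (hd g (γ t * 1)) (hd (γ t) 1)
      rw [hcomp, this]
      rfl
    unfold mulInvariantVectorField
    rw [h3]
    congr 2
    exact mul_one _
  refine ((hd g (γ t)).hasMFDerivAt.comp_hasMFDerivWithinAt t h1).congr_mfderiv ?_
  refine ContinuousLinearMap.ext_ring ?_
  change mfderiv 𝓘(ℝ, E) 𝓘(ℝ, E) (fun c : G ↦ g * c) (γ t)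
    ((1 : ℝ) • mulInvariantVectorField x (γ t)) = (1 : ℝ) • mulInvariantVectorField x (g * γ t)
  rw [one_smul, one_smul, key]

/-- The curve `t ↦ exp (t x)` in a Lie group: the integral curve through `1` of the left-invariant
vector field of `x`. -/
noncomputable def expCurve [T2Space G] (x : GroupLieAlgebra 𝓘(ℝ, E) G) : ℝ → G :=
  (exists_expCurve x).choose

/-- An Euler element of the Lie algebra: `ad h` is non-zero and diagonalizable, with all its
eigenvalues in `{-1, 0, 1}`. -/
structure IsEulerElement (h : GroupLieAlgebra 𝓘(ℝ, E) G) : Prop where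
  ad_ne_zero : LieAlgebra.ad ℝ (GroupLieAlgebra 𝓘(ℝ, E) G) h ≠ 0
  diagonalizable :
    Module.End.eigenspace (LieAlgebra.ad ℝ (GroupLieAlgebra 𝓘(ℝ, E) G) h) (-1) ⊔
      Module.End.eigenspace (LieAlgebra.ad ℝ (GroupLieAlgebra 𝓘(ℝ, E) G) h) 0 ⊔
      Module.End.eigenspace (LieAlgebra.ad ℝ (GroupLieAlgebra 𝓘(ℝ, E) G) h) 1 = ⊤

/-- `τ` is an involutive automorphism of the Lie group `G` whose differential at the identity is
`e^{πi ad h}`, for an Euler element `h`: on an eigenvector of `ad h` with eigenvalue `n`, the latter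
is multiplication by `e^{πi n} = (-1)^n`. -/
structure IsEulerInvolution (h : GroupLieAlgebra 𝓘(ℝ, E) G) (τ : MulAut G) : Prop where
  smooth : ContMDiff 𝓘(ℝ, E) 𝓘(ℝ, E) ∞ (τ : G → G)
  involutive : τ * τ = 1
  differential : ∀ (n : ℤ) (x : GroupLieAlgebra 𝓘(ℝ, E) G), ⁅h, x⁆ = (n : ℝ) • x →
    mfderiv 𝓘(ℝ, E) 𝓘(ℝ, E) (τ : G → G) 1 x = ((-1 : ℝ) ^ n) • x

end LieGroups

/-! ### Antiunitary representations -/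

section Representations

/-- The group `AU(H)` of all unitary or antiunitary operators on a complex Hilbert space, as a
subgroup of the group of surjective real-linear isometries. -/
noncomputable def antiunitaryGroup (H : Type*) [NormedAddCommGroup H] [InnerProductSpace ℂ H] :
    Subgroup (H ≃ₗᵢ[ℝ] H) where
  carrier := {T | (∀ (c : ℂ) (x : H), T (c • x) = c • T x) ∨
    (∀ (c : ℂ) (x : H), T (c • x) = (starRingEnd ℂ) c • T x)}
  one_mem' := Or.inl fun _ _ ↦ rfl
  mul_mem' := by
    rintro S T (hS | hS) (hT | hT)
    · exact Or.inl fun c x ↦ by simp [hS, hT]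
    · exact Or.inr fun c x ↦ by simp [hS, hT]
    · exact Or.inr fun c x ↦ by simp [hS, hT]
    · exact Or.inl fun c x ↦ by simp [hS, hT]
  inv_mem' := by
    rintro T (hT | hT)
    · refine Or.inl fun c x ↦ T.injective ?_
      rw [hT]
      change T (T.symm (c • x)) = c • T (T.symm x)
      simp
    · refine Or.inr fun c x ↦ T.injective ?_
      rw [hT]
      change T (T.symm (c • x)) = _ • T (T.symm x)
      simp

/-- The extension `G_τ = G ⋊ {id, τ}` of a group by an involutive automorphism. -/
abbrev ExtendedGroup {G : Type*} [Group G] (τ : MulAut G) : Type _ :=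
  G ⋊[(Subgroup.zpowers τ).subtype] (Subgroup.zpowers τ)

/-- An antiunitary representation of `G_τ = G ⋊ {id, τ}` on `H`: a strongly continuous homomorphism
to `AU(H)` that maps `G` to unitary operators and `τ` to an antiunitary one. -/
structure AntiunitaryRep {G : Type*} [Group G] [TopologicalSpace G] (τ : MulAut G)
    (H : Type*) [NormedAddCommGroup H] [InnerProductSpace ℂ H] where
  toHom : ExtendedGroup τ →* antiunitaryGroup H
  unitary : ∀ (g : G) (c : ℂ) (ξ : H),
    (toHom (SemidirectProduct.inl g)).1 (c • ξ) = c • (toHom (SemidirectProduct.inl g)).1 ξ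
  antiunitary : ∀ (c : ℂ) (ξ : H),
    (toHom (SemidirectProduct.inr ⟨τ, Subgroup.mem_zpowers τ⟩)).1 (c • ξ) =
      (starRingEnd ℂ) c • (toHom (SemidirectProduct.inr ⟨τ, Subgroup.mem_zpowers τ⟩)).1 ξ
  continuous : ∀ ξ : H, Continuous fun g : G ↦ (toHom (SemidirectProduct.inl g)).1 ξ

variable {G : Type*} [Group G] [TopologicalSpace G] {τ : MulAut G}
  {H : Type*} [NormedAddCommGroup H] [InnerProductSpace ℂ H]

/-- The unitary operator `U(g)`, for `g ∈ G`. -/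
noncomputable def AntiunitaryRep.U (U : AntiunitaryRep τ H) (g : G) : H ≃ₗᵢ[ℂ] H where
  toFun := (U.toHom (SemidirectProduct.inl g)).1
  invFun := (U.toHom (SemidirectProduct.inl g)).1.symm
  left_inv := (U.toHom (SemidirectProduct.inl g)).1.left_inv
  right_inv := (U.toHom (SemidirectProduct.inl g)).1.right_inv
  map_add' := map_add _
  map_smul' := U.unitary g
  norm_map' := (U.toHom (SemidirectProduct.inl g)).1.norm_map

/-- The conjugation `J = U(τ)`. -/
noncomputable def AntiunitaryRep.J (U : AntiunitaryRep τ H) : H ≃ₗᵢ[ℝ] H :=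
  (U.toHom (SemidirectProduct.inr ⟨τ, Subgroup.mem_zpowers τ⟩)).1

end Representations

/-! ### Generators of unitary one-parameter groups and their exponentials -/

section Generators

variable {H : Type*} [NormedAddCommGroup H] [InnerProductSpace ℂ H]

/-- The infinitesimal generator `ξ ↦ d/dt|_{t = 0} u_t ξ` of a unitary one-parameter group, defined
on the space of all `ξ` for which this derivative exists. -/
noncomputable def infinitesimalGenerator (u : ℝ → H ≃ₗᵢ[ℂ] H) : H →ₗ.[ℂ] H where
  domain :=
    { carrier := {ξ | DifferentiableAt ℝ (fun t ↦ u t ξ) 0}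
      zero_mem' := by simp
      add_mem' := fun {ξ η} hξ hη ↦ by
        have := DifferentiableAt.add hξ hη
        simpa [Pi.add_def] using this
      smul_mem' := fun c ξ hξ ↦ by
        have := DifferentiableAt.const_smul hξ c
        simpa [Pi.smul_def] using this }
  toFun :=
    { toFun := fun ξ ↦ deriv (fun t ↦ u t ξ) 0
      map_add' := fun ξ η ↦ by
        have := deriv_add ξ.2 η.2
        simpa [Pi.add_def] using this
      map_smul' := fun c ξ ↦ by
        have := deriv_const_smul c ξ.2
        simpa [Pi.smul_def] using this }

/-- The graph of the exponential series `ξ ↦ ∑ zⁿ/n! Aⁿ ξ` on the entire vectors of an operator `A`,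
i.e. on the vectors `ξ` in the domains of all powers of `A` with `∑ rⁿ/n! ‖Aⁿ ξ‖ < ∞` for all `r`.
The sequence `a` is `n ↦ Aⁿ ξ`. -/
def expSeriesGraph (A : H →ₗ.[ℂ] H) (z : ℂ) : Submodule ℂ (H × H) where
  carrier := {p | ∃ a : ℕ → H, a 0 = p.1 ∧ (∀ n, (a n, a (n + 1)) ∈ A.graph) ∧
    (∀ r : ℝ, Summable fun n ↦ r ^ n / (n.factorial : ℝ) * ‖a n‖) ∧
    HasSum (fun n ↦ (z ^ n / (n.factorial : ℂ)) • a n) p.2}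
  zero_mem' := ⟨fun _ ↦ 0, rfl, fun _ ↦ A.graph.zero_mem, fun r ↦ by simp, by simp⟩
  add_mem' := by
    rintro p q ⟨a, ha0, ha, has, haz⟩ ⟨b, hb0, hb, hbs, hbz⟩
    refine ⟨fun n ↦ a n + b n, by simp [ha0, hb0], fun n ↦ A.graph.add_mem (ha n) (hb n),
      fun r ↦ ?_, by simpa [smul_add] using haz.add hbz⟩
    refine Summable.of_norm_bounded ((has |r|).add (hbs |r|)) fun n ↦ ?_
    rw [norm_mul, norm_div, norm_pow, norm_norm, Real.norm_eq_abs, RCLike.norm_natCast, ← mul_add]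
    gcongr
    exact norm_add_le _ _
  smul_mem' := by
    rintro c p ⟨a, ha0, ha, has, haz⟩
    refine ⟨fun n ↦ c • a n, by simp [ha0], fun n ↦ A.graph.smul_mem c (ha n), fun r ↦ ?_, ?_⟩
    · simpa [norm_smul, mul_left_comm] using (has r).mul_left ‖c‖
    · simpa [smul_comm _ c] using haz.const_smul c

/-- The graph of the closed operator `e^{zA}`, for a skew-adjoint operator `A`: the entire vectors
are a core of `e^{zA}`, and on them it is given by the exponential series. -/
noncomputable def expGraph (A : H →ₗ.[ℂ] H) (z : ℂ) : ClosedSubmodule ℂ (H × H) :=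
  (expSeriesGraph A z).closure

end Generators

/-! ### Standard subspaces -/

section StandardSubspaces

variable {H : Type*} [NormedAddCommGroup H] [InnerProductSpace ℂ H]

/-- A closed real subspace `S` is separating if `S ∩ iS = {0}`. -/
def ClosedSubmodule.IsSeparating (S : ClosedSubmodule ℝ H) : Prop := S ⊓ S.mulI = ⊥

/-- A closed real subspace `S` is cyclic if `S + iS` is dense (the supremum of closed subspaces is
the closure of their sum). -/
def ClosedSubmodule.IsCyclic (S : ClosedSubmodule ℝ H) : Prop := S ⊔ S.mulI = ⊤

/-- A closed real subspace is standard if it is cyclic and separating. -/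
def ClosedSubmodule.IsStandard (S : ClosedSubmodule ℝ H) : Prop := S.IsCyclic ∧ S.IsSeparating

/-- The image of a closed real subspace under a unitary operator. -/
noncomputable def ClosedSubmodule.image (T : H ≃ₗᵢ[ℂ] H) (S : ClosedSubmodule ℝ H) :
    ClosedSubmodule ℝ H :=
  S.mapEquiv (T.toContinuousLinearEquiv.restrictScalars ℝ)

variable {E : Type*} [NormedAddCommGroup E] [NormedSpace ℝ E] [FiniteDimensional ℝ E]
  {G : Type*} [TopologicalSpace G] [ChartedSpace E G] [Group G] [LieGroup 𝓘(ℝ, E) ∞ G]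
  [T2Space G]

/-- The square root `Δ^{1/2} = e^{πi ∂U(h)}` of the modular operator `Δ = e^{2πi ∂U(h)}`, through its
graph. Here `∂U(h)` is the generator of `t ↦ U(exp (t h))`. -/
noncomputable def sqrtModularGraph {τ : MulAut G} (h : GroupLieAlgebra 𝓘(ℝ, E) G)
    (U : AntiunitaryRep τ H) : ClosedSubmodule ℂ (H × H) :=
  expGraph (infinitesimalGenerator fun t ↦ U.U (expCurve h t)) (Real.pi * Complex.I)

/-- The canonical standard subspace `V(h, U) = Fix(J Δ^{1/2})` with modular objects
`Δ = e^{2πi ∂U(h)}` and `J = U(τ)`. -/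
noncomputable def canonicalSubspace {τ : MulAut G} (h : GroupLieAlgebra 𝓘(ℝ, E) G)
    (U : AntiunitaryRep τ H) : ClosedSubmodule ℝ H where
  carrier := {ξ | ∃ η, (ξ, η) ∈ sqrtModularGraph h U ∧ U.J η = ξ}
  zero_mem' := ⟨0, (sqrtModularGraph h U).zero_mem, map_zero _⟩
  add_mem' := by
    rintro ξ ξ' ⟨η, h1, h2⟩ ⟨η', h1', h2'⟩
    exact ⟨η + η', (sqrtModularGraph h U).add_mem h1 h1', by rw [map_add, h2, h2']⟩
  smul_mem' := by
    rintro c ξ ⟨η, h1, h2⟩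
    refine ⟨c • η, ?_, by rw [map_smul, h2]⟩
    simpa using (sqrtModularGraph h U).smul_mem (c : ℂ) h1
  isClosed' := by
    have hc : Continuous fun ξ : H ↦ (ξ, U.J.symm ξ) := by fun_prop
    convert (sqrtModularGraph h U).isClosed.preimage hc using 1
    ext ξ
    constructor
    · rintro ⟨η, h1, rfl⟩
      simpa using h1
    · intro h1
      exact ⟨_, h1, by simp⟩

end StandardSubspaces

/-! ### Nets of real subspaces on a homogeneous space -/

section Nets

variable {G : Type*} [Group G] [TopologicalSpace G] [IsTopologicalGroup G] {L : Subgroup G}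
  {τ : MulAut G} {H : Type*} [NormedAddCommGroup H] [InnerProductSpace ℂ H]

/-- The translate `gO` of an open subset of the homogeneous space `G ⧸ L`. -/
def translateOpens (g : G) (O : Opens (G ⧸ L)) : Opens (G ⧸ L) :=
  ⟨g • (O : Set (G ⧸ L)), O.isOpen.smul g⟩

/-- The maximal net `O ↦ ⋂ {U(g) V | O ⊆ gW}`. -/
noncomputable def maxNet (U : AntiunitaryRep τ H) (V : ClosedSubmodule ℝ H) (W : Opens (G ⧸ L))
    (O : Opens (G ⧸ L)) : ClosedSubmodule ℝ H :=
  ⨅ g : {g : G // O ≤ translateOpens g W}, V.image (U.U g)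

/-- The minimal net `O ↦ closure (∑ {U(g) V | gW ⊆ O})`; the supremum of closed subspaces is the
closure of their sum. -/
noncomputable def minNet (U : AntiunitaryRep τ H) (V : ClosedSubmodule ℝ H) (W : Opens (G ⧸ L))
    (O : Opens (G ⧸ L)) : ClosedSubmodule ℝ H :=
  ⨆ g : {g : G // translateOpens g W ≤ O}, V.image (U.U g)

/-- (Iso): `O₁ ⊆ O₂` implies `N(O₁) ⊆ N(O₂)`. -/
def IsIsotone (N : Opens (G ⧸ L) → ClosedSubmodule ℝ H) : Prop :=
  ∀ O₁ O₂ : Opens (G ⧸ L), O₁ ≤ O₂ → N O₁ ≤ N O₂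

/-- (Cov): `U(g) N(O) = N(gO)`. -/
def IsCovariant (U : AntiunitaryRep τ H) (N : Opens (G ⧸ L) → ClosedSubmodule ℝ H) : Prop :=
  ∀ (g : G) (O : Opens (G ⧸ L)), (N O).image (U.U g) = N (translateOpens g O)

/-- The compression semigroup `S_W = {g | gW ⊆ W}`. -/
def compressionSemigroup (W : Opens (G ⧸ L)) : Set G :=
  {g | translateOpens g W ≤ W}

/-- The endomorphism semigroup `S_V = {g | U(g) V ⊆ V}`. -/
def endomorphismSemigroup (U : AntiunitaryRep τ H) (V : ClosedSubmodule ℝ H) : Set G :=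
  {g | V.image (U.U g) ≤ V}

end Nets

/-! Isotony and covariance are formal, and covariance carries cyclicity of the maximal net along
`G`-orbits. Taking `g = 1` gives `maxNet W ≤ V ≤ minNet W`, and equality at either end unwinds to
`S_W ⊆ S_V`. The analytic content is that `V` is standard and rigid: a closed real subspace
invariant under the modular group equals `V` if it is cyclic and inside `V`, or separating and
contains `V`. Both nets at `W` are invariant because `exp(th)W = W`.

The tool is Gaussian smoothing in place of spectral calculus. A smoothed vector has an entire orbit
`F`, so the exponential series of the generator `A` is the Taylor series of `F` and `e^{wA} F(z) =
F(z + w)`. Hence smoothed vectors lie in the domain of `Δ^{1/2}` and split as `x + iy` with `x, y ∈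
V`. If `K ⊇ V` is separating and invariant, the smoothing of a vector of `K` stays in `K`, so `y`
and `iy` both lie in `K`; thus `y = 0`, and removing the smoothing gives `K = V`
(`eq_of_le_of_isSeparating`). The cyclic case follows by passing to `J` of the symplectic complement
(`eq_of_le_of_isCyclic`). -/

open MeasureTheory Filter Topology

/-! ### Gaussian smoothing of unitary orbits. -/

section OneParameterGroups

variable {H : Type*} [NormedAddCommGroup H] [InnerProductSpace ℂ H]

/-- A strongly continuous unitary one-parameter group. -/
structure IsUnitaryOneParameterGroup (u : ℝ → H ≃ₗᵢ[ℂ] H) : Prop where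
  zero : ∀ ξ, u 0 ξ = ξ
  add : ∀ s t ξ, u (s + t) ξ = u s (u t ξ)
  continuous : ∀ ξ, Continuous fun t ↦ u t ξ

/-- An antilinear involutive isometry commuting with a unitary one-parameter group. -/
structure IsCommutingConjugation (J : H ≃ₗᵢ[ℝ] H) (u : ℝ → H ≃ₗᵢ[ℂ] H) : Prop where
  smul : ∀ (c : ℂ) ξ, J (c • ξ) = (starRingEnd ℂ) c • J ξ
  involutive : ∀ ξ, J (J ξ) = ξ
  commute : ∀ t ξ, J (u t ξ) = u t (J ξ)

/-- An entire function `F` is an entire orbit of `u` if `u s (F z) = F (z + s)`. -/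
structure IsEntireOrbit (u : ℝ → H ≃ₗᵢ[ℂ] H) (F : ℂ → H) : Prop where
  differentiable : Differentiable ℂ F
  map_add : ∀ (s : ℝ) z, u s (F z) = F (z + s)

/-- The entire orbit obtained by smoothing the orbit of `ξ` with a Gaussian. -/
noncomputable def gaussianOrbit (u : ℝ → H ≃ₗᵢ[ℂ] H) (b : ℝ) (ξ : H) (z : ℂ) : H :=
  ∫ t : ℝ, Complex.exp (-b * (t - z) ^ 2) • u t ξ

variable {u : ℝ → H ≃ₗᵢ[ℂ] H}

/-- The exponent has real part `-b((t - Re z)² - (Im z)²)`, and `(t - x)² ≥ t²/2 - x²`. The constant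
3 is generous; what matters is uniformity on `‖z‖ ≤ R`. -/
theorem norm_cexp_gaussian_le {b R : ℝ} (hb : 0 < b) {z : ℂ} (hz : ‖z‖ ≤ R) (t : ℝ) :
    ‖Complex.exp (-b * (t - z) ^ 2)‖ ≤ Real.exp (3 * b * R ^ 2) * Real.exp (-(b / 2) * t ^ 2) := by
  rw [Complex.norm_exp, ← Real.exp_add, Real.exp_le_exp]
  have hre : (-b * (t - z) ^ 2 : ℂ).re = -b * ((t - z.re) ^ 2 - z.im ^ 2) := by
    simp [pow_two, Complex.mul_re]
  have h1 : z.re ^ 2 + z.im ^ 2 ≤ R ^ 2 := by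
    have := Complex.sq_norm z
    rw [Complex.normSq_apply] at this
    nlinarith [norm_nonneg z]
  rw [hre]
  have h2 : (t - z.re) ^ 2 - z.im ^ 2 ≥ t ^ 2 / 2 - 3 * R ^ 2 := by
    nlinarith [sq_nonneg (t - 2 * z.re), sq_nonneg z.re, sq_nonneg z.im]
  nlinarith

/-- Half of the decay rate `b/2` pays for the linear factor: `|t| ≤ bt²/4 + 1/b`, and `s ≤ e^s`.
This dominates the differentiated integrand. -/
theorem norm_cexp_gaussian_deriv_le {b R : ℝ} (hb : 0 < b) {z : ℂ} (hz : ‖z‖ ≤ R) (t : ℝ) :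
    ‖2 * b * (t - z) * Complex.exp (-b * (t - z) ^ 2)‖ ≤
      2 * b * Real.exp (1 / b + R + 3 * b * R ^ 2) * Real.exp (-(b / 4) * t ^ 2) := by
  have h1 : ‖(t - z : ℂ)‖ ≤ Real.exp (b / 4 * t ^ 2 + 1 / b + R) := by
    have h2 : ‖(t - z : ℂ)‖ ≤ |t| + R := by
      refine (norm_sub_le _ _).trans ?_
      simpa using hz
    have h3 : |t| ≤ b / 4 * t ^ 2 + 1 / b := by
      have h4 : b / 4 * t ^ 2 + 1 / b - |t| = b * (|t| / 2 - 1 / b) ^ 2 := by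
        rw [← sq_abs t]; field_simp; ring
      have : 0 ≤ b * (|t| / 2 - 1 / b) ^ 2 := by positivity
      linarith
    have := Real.add_one_le_exp (b / 4 * t ^ 2 + 1 / b + R)
    linarith
  have h5 := norm_cexp_gaussian_le hb hz t
  calc ‖2 * b * (t - z) * Complex.exp (-b * (t - z) ^ 2)‖
      = 2 * b * ‖(t - z : ℂ)‖ * ‖Complex.exp (-b * (t - z) ^ 2)‖ := by
        rw [norm_mul, norm_mul, norm_mul, Complex.norm_real, Real.norm_of_nonneg hb.le]; simp
    _ ≤ 2 * b * Real.exp (b / 4 * t ^ 2 + 1 / b + R) *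
          (Real.exp (3 * b * R ^ 2) * Real.exp (-(b / 2) * t ^ 2)) := by gcongr
    _ = _ := by
        rw [← Real.exp_add, mul_assoc, ← Real.exp_add, mul_assoc _ (Real.exp _), ← Real.exp_add]
        congr 2
        ring

theorem integrable_gaussianOrbit (hu : IsUnitaryOneParameterGroup u) {b : ℝ} (hb : 0 < b) (ξ : H)
    (z : ℂ) : Integrable fun t : ℝ ↦ Complex.exp (-b * (t - z) ^ 2) • u t ξ := by
  have hc := hu.continuous ξ
  refine Integrable.mono' (((integrable_exp_neg_mul_sq (half_pos hb)).const_mul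
    (Real.exp (3 * b * ‖z‖ ^ 2))).mul_const ‖ξ‖)
    (Continuous.aestronglyMeasurable (by fun_prop)) (ae_of_all _ fun t ↦ ?_)
  rw [norm_smul, LinearIsometryEquiv.norm_map]
  gcongr
  exact norm_cexp_gaussian_le hb le_rfl t

theorem differentiable_gaussianOrbit (hu : IsUnitaryOneParameterGroup u) {b : ℝ} (hb : 0 < b)
    (ξ : H) : Differentiable ℂ (gaussianOrbit u b ξ) := by
  intro z
  have hc := hu.continuous ξ
  refine (hasDerivAt_integral_of_dominated_loc_of_deriv_le
    (F := fun (w : ℂ) (t : ℝ) ↦ Complex.exp (-b * (t - w) ^ 2) • u t ξ)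
    (F' := fun (w : ℂ) (t : ℝ) ↦ (2 * b * (t - w) * Complex.exp (-b * (t - w) ^ 2)) • u t ξ)
    (bound := fun t ↦ 2 * b * Real.exp (1 / b + (‖z‖ + 1) + 3 * b * (‖z‖ + 1) ^ 2) *
      Real.exp (-(b / 4) * t ^ 2) * ‖ξ‖)
    (Metric.ball_mem_nhds z one_pos)
    (Eventually.of_forall fun w ↦ (integrable_gaussianOrbit hu hb ξ w).aestronglyMeasurable)
    (integrable_gaussianOrbit hu hb ξ z) (Continuous.aestronglyMeasurable (by fun_prop))
    (ae_of_all _ fun t w hw ↦ ?_)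
    (((integrable_exp_neg_mul_sq (by positivity)).const_mul _).mul_const _)
    (ae_of_all _ fun t w hw ↦ ?_)).2.differentiableAt
  · rw [norm_smul, LinearIsometryEquiv.norm_map]
    gcongr
    refine norm_cexp_gaussian_deriv_le hb ?_ t
    rw [Metric.mem_ball, dist_eq_norm] at hw
    have := norm_add_le (w - z) z
    rw [sub_add_cancel] at this
    linarith
  · refine HasDerivAt.smul_const ?_ (u t ξ)
    have h1 := ((((hasDerivAt_id w).const_sub (t : ℂ)).pow 2).const_mul (-b : ℂ)).cexp
    refine h1.congr_deriv ?_
    simp only [Pi.pow_apply, id_eq]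
    push_cast
    ring

theorem isEntireOrbit_gaussianOrbit (hu : IsUnitaryOneParameterGroup u) {b : ℝ} (hb : 0 < b)
    (ξ : H) : IsEntireOrbit u (gaussianOrbit u b ξ) := by
  refine ⟨differentiable_gaussianOrbit hu hb ξ, fun s z ↦ ?_⟩
  unfold gaussianOrbit
  refine ((u s).toContinuousLinearEquiv.integral_comp_comm _).symm.trans ?_
  -- Translating the integration variable by `s` turns the shift of the kernel into the action of `u
  -- s`.
  rw [← integral_add_right_eq_self (fun t : ℝ ↦ Complex.exp (-b * (t - (z + s)) ^ 2) • u t ξ) s]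
  refine integral_congr_ae (ae_of_all _ fun t ↦ ?_)
  change u s _ = _
  rw [map_smul, ← hu.add, add_comm s t]
  push_cast
  ring_nf

theorem IsCommutingConjugation.map_gaussianOrbit {J : H ≃ₗᵢ[ℝ] H}
    (hJ : IsCommutingConjugation J u) (b : ℝ) (ξ : H) (z : ℂ) :
    J (gaussianOrbit u b ξ z) = gaussianOrbit u b (J ξ) ((starRingEnd ℂ) z) := by
  unfold gaussianOrbit
  refine (J.toContinuousLinearEquiv.integral_comp_comm _).symm.trans ?_
  refine integral_congr_ae (ae_of_all _ fun t ↦ ?_)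
  change J _ = _
  rw [hJ.smul, hJ.commute, ← Complex.exp_conj]
  simp

/-- At `z = 0` the kernel is real, so the integral can be formed inside the complete real space `K`.
-/
theorem gaussianOrbit_zero_mem [CompleteSpace H] (hu : IsUnitaryOneParameterGroup u) {b : ℝ}
    (hb : 0 < b) (K : ClosedSubmodule ℝ H) {ξ : H} (hK : ∀ t, u t ξ ∈ K) :
    gaussianOrbit u b ξ 0 ∈ K := by
  have : CompleteSpace K.toSubmodule := K.isClosed.completeSpace_coe
  let f : ℝ → K.toSubmodule := fun t ↦ Real.exp (-b * t ^ 2) • ⟨u t ξ, hK t⟩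
  have hf : ∀ t : ℝ, (Complex.exp (-b * (t - 0) ^ 2) • u t ξ : H) = K.toSubmodule.subtypeL (f t) := by
    intro t
    simp only [f, map_smul, Submodule.subtypeL_apply]
    rw [← Complex.coe_smul]
    push_cast
    simp
  have hfi : Integrable f := by
    have hc := hu.continuous ξ
    refine (integrable_gaussianOrbit hu hb ξ 0).mono (Continuous.aestronglyMeasurable ?_)
      (ae_of_all _ fun t ↦ ?_)
    · exact Continuous.smul (f := fun t : ℝ ↦ Real.exp (-b * t ^ 2)) (by fun_prop) (hc.subtype_mk _)
    · rw [hf]; rfl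
  unfold gaussianOrbit
  simp_rw [hf]
  rw [ContinuousLinearMap.integral_comp_comm _ hfi]
  exact (∫ t, f t).2

/-- For `b = (n + 1)²` the normalizing factor `√(b/π)` is `(n + 1)/√π`. Rescaling time fixes the
Gaussian and slows the orbit down, so dominated convergence applies. -/
theorem tendsto_smul_gaussianOrbit (hu : IsUnitaryOneParameterGroup u) [CompleteSpace H] (ξ : H) :
    Tendsto (fun n : ℕ ↦ (Real.sqrt Real.pi)⁻¹ • ((n : ℝ) + 1) •
      gaussianOrbit u (((n : ℝ) + 1) ^ 2) ξ 0) atTop (𝓝 ξ) := by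
  have hs : Real.sqrt Real.pi ≠ 0 := (Real.sqrt_pos.2 Real.pi_pos).ne'
  have h1 : ∀ n : ℕ, ((n : ℝ) + 1) • gaussianOrbit u (((n : ℝ) + 1) ^ 2) ξ 0 =
      ∫ t : ℝ, Real.exp (-1 * t ^ 2) • u (((n : ℝ) + 1)⁻¹ * t) ξ := by
    intro n
    have hn : (0 : ℝ) < (n : ℝ) + 1 := by positivity
    have h2 := Measure.integral_comp_mul_left
      (fun t : ℝ ↦ Real.exp (-1 * t ^ 2) • u (((n : ℝ) + 1)⁻¹ * t) ξ) ((n : ℝ) + 1)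
    rw [abs_of_pos (inv_pos.2 hn)] at h2
    rw [← smul_inv_smul₀ hn.ne' (∫ t : ℝ, Real.exp (-1 * t ^ 2) • u (((n : ℝ) + 1)⁻¹ * t) ξ), ← h2]
    congr 1
    refine integral_congr_ae (ae_of_all _ fun t ↦ ?_)
    simp only
    rw [inv_mul_cancel_left₀ hn.ne', ← Complex.coe_smul]
    push_cast
    congr 2
    ring
  have h3 : Tendsto (fun n : ℕ ↦ ∫ t : ℝ, Real.exp (-1 * t ^ 2) • u (((n : ℝ) + 1)⁻¹ * t) ξ) atTop
      (𝓝 (∫ t : ℝ, Real.exp (-1 * t ^ 2) • ξ)) := by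
    have hc := hu.continuous ξ
    refine tendsto_integral_of_dominated_convergence (fun t ↦ Real.exp (-1 * t ^ 2) * ‖ξ‖)
      (fun n ↦ Continuous.aestronglyMeasurable ?_)
      ((integrable_exp_neg_mul_sq one_pos).mul_const _)
      (fun n ↦ ae_of_all _ fun t ↦ ?_) (ae_of_all _ fun t ↦ ?_)
    · exact Continuous.smul (f := fun t : ℝ ↦ Real.exp (-1 * t ^ 2)) (by fun_prop) (hc.comp (by fun_prop))
    · rw [norm_smul, LinearIsometryEquiv.norm_map, Real.norm_of_nonneg (Real.exp_nonneg _)]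
    · refine Tendsto.const_smul ?_ _
      have h4 : Tendsto (fun n : ℕ ↦ ((n : ℝ) + 1)⁻¹ * t) atTop (𝓝 0) := by
        simpa [one_div] using (tendsto_one_div_add_atTop_nhds_zero_nat (𝕜 := ℝ)).mul_const t
      have h5 := (hc.tendsto 0).comp h4
      rwa [hu.zero] at h5
  simp_rw [h1]
  have h6 : ξ = (Real.sqrt Real.pi)⁻¹ • ∫ t : ℝ, Real.exp (-1 * t ^ 2) • ξ := by
    rw [integral_smul_const, integral_gaussian, div_one, inv_smul_smul₀ hs]
  conv_rhs => rw [h6]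
  exact h3.const_smul _

theorem mem_of_gaussianOrbit_mem [CompleteSpace H] (hu : IsUnitaryOneParameterGroup u)
    (K : ClosedSubmodule ℝ H) {ξ : H} (hK : ∀ b > 0, gaussianOrbit u b ξ 0 ∈ K) : ξ ∈ K :=
  K.isClosed.mem_of_tendsto (tendsto_smul_gaussianOrbit hu ξ) <| Eventually.of_forall fun n ↦
    K.toSubmodule.smul_mem _ <| K.toSubmodule.smul_mem _ <| hK _ (by positivity)

/-! ### Entire orbits and the exponential of the generator. -/

theorem isEntireOrbit_iteratedDeriv [CompleteSpace H] {F : ℂ → H} (hF : IsEntireOrbit u F) (n : ℕ) :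
    IsEntireOrbit u (iteratedDeriv n F) := by
  induction n with
  | zero => simpa using hF
  | succ n ih =>
    rw [iteratedDeriv_succ]
    refine ⟨fun z ↦ ?_, fun s z ↦ ?_⟩
    · exact ((ih.differentiable.differentiableOn (s := Set.univ)).deriv isOpen_univ
        ).differentiableAt univ_mem
    · have h1 := ((u s).toContinuousLinearEquiv.toContinuousLinearMap.hasFDerivAt.comp_hasDerivAt z
        (ih.differentiable z).hasDerivAt).deriv
      have h2 : (⇑(u s).toContinuousLinearEquiv.toContinuousLinearMap ∘ iteratedDeriv n F) =
          fun z ↦ iteratedDeriv n F (z + s) := funext fun z ↦ ih.map_add s z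
      rw [h2, deriv_comp_add_const] at h1
      exact h1.symm

theorem IsEntireOrbit.mem_graph [CompleteSpace H] {F : ℂ → H} (hF : IsEntireOrbit u F) (z : ℂ) :
    (F z, deriv F z) ∈ (infinitesimalGenerator u).graph := by
  have h1 : HasDerivAt (fun t : ℝ ↦ u t (F z)) (deriv F z) 0 := by
    simp_rw [hF.map_add]
    have h2 : HasDerivAt F (deriv F z) (z + (0 : ℝ)) := by
      simpa using (hF.differentiable z).hasDerivAt
    have h3 : HasDerivAt (fun t : ℝ ↦ z + (t : ℂ)) 1 0 :=
      (Complex.ofRealCLM.hasDerivAt (x := 0)).const_add z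
    simpa [Function.comp_def] using h2.scomp (0 : ℝ) h3
  rw [LinearPMap.mem_graph_iff]
  exact ⟨⟨F z, h1.differentiableAt⟩, rfl, h1.deriv⟩

/-- The Taylor terms at distance `2|r|` from `z` are bounded, so those at distance `|r|` are
dominated by a geometric series of ratio `1/2`. -/
theorem summable_norm_taylor [CompleteSpace H] {F : ℂ → H} (hF : Differentiable ℂ F) (z : ℂ)
    (r : ℝ) : Summable fun n ↦ r ^ n / (n.factorial : ℝ) * ‖iteratedDeriv n F z‖ := by
  have h1 := (Complex.hasSum_taylorSeries_of_entire hF z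
    (z + (2 * |r| : ℝ))).summable.tendsto_atTop_zero.norm
  obtain ⟨C, hC⟩ := h1.bddAbove_range
  refine Summable.of_norm_bounded (summable_geometric_two.mul_left C) fun n ↦ ?_
  have h2 := hC ⟨n, rfl⟩
  simp only [add_sub_cancel_left, norm_smul, norm_inv, norm_pow, Complex.norm_real,
    Complex.norm_natCast, norm_mul, Real.norm_eq_abs, abs_abs, abs_two] at h2 ⊢
  rw [abs_norm, abs_div, abs_pow, Nat.abs_cast]
  rw [one_div, inv_pow, ← div_eq_mul_inv, le_div_iff₀ (by positivity)]
  refine le_trans (le_of_eq ?_) h2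
  rw [mul_pow]
  field_simp

/-- Since `Aⁿ F = F⁽ⁿ⁾`, the exponential series at `F z` is the Taylor series of `F` about `z`. -/
theorem IsEntireOrbit.mem_expSeriesGraph [CompleteSpace H] {F : ℂ → H} (hF : IsEntireOrbit u F)
    (z w : ℂ) : (F z, F (z + w)) ∈ expSeriesGraph (infinitesimalGenerator u) w := by
  refine ⟨fun n ↦ iteratedDeriv n F z, by simp, fun n ↦ ?_, summable_norm_taylor hF.differentiable z,
    ?_⟩
  · beta_reduce
    rw [iteratedDeriv_succ]
    exact (isEntireOrbit_iteratedDeriv hF n).mem_graph z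
  · convert Complex.hasSum_taylorSeries_of_entire hF.differentiable z (z + w) using 2 with n
    rw [add_sub_cancel_left, smul_smul, div_eq_inv_mul]

open scoped InnerProductSpace

/-- Differentiate the constant function `t ↦ ⟪u t x, u t y⟫` at `0`. -/
theorem inner_infinitesimalGenerator (hu : IsUnitaryOneParameterGroup u) {x x' y y' : H}
    (hx : (x, x') ∈ (infinitesimalGenerator u).graph)
    (hy : (y, y') ∈ (infinitesimalGenerator u).graph) : ⟪x', y⟫_ℂ = -⟪x, y'⟫_ℂ := by
  have key : ∀ {x x' : H}, (x, x') ∈ (infinitesimalGenerator u).graph →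
      HasDerivAt (fun t ↦ u t x) x' 0 := fun hx ↦ by
    obtain ⟨x, rfl, rfl⟩ := (LinearPMap.mem_graph_iff _).1 hx
    exact DifferentiableAt.hasDerivAt x.2
  have h1 := (key hx).inner ℂ (key hy)
  simp only [LinearIsometryEquiv.inner_map_map, hu.zero] at h1
  have h2 := h1.unique (hasDerivAt_const _ _)
  rw [eq_neg_iff_add_eq_zero, add_comm]
  exact h2

/-- Moving `Aⁿ` across the inner product costs `(-1)ⁿ`, which cancels the sign from conjugating
`(ic)ⁿ`; this needs `c` real. -/
theorem inner_expSeriesGraph (hu : IsUnitaryOneParameterGroup u) {p q : H × H} (c : ℝ)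
    (hp : p ∈ expSeriesGraph (infinitesimalGenerator u) (c * Complex.I))
    (hq : q ∈ expSeriesGraph (infinitesimalGenerator u) (c * Complex.I)) :
    ⟪p.2, q.1⟫_ℂ = ⟪p.1, q.2⟫_ℂ := by
  obtain ⟨a, ha0, ha, -, has⟩ := hp
  obtain ⟨b, hb0, hb, -, hbs⟩ := hq
  have h1 : ∀ n m, ⟪a n, b m⟫_ℂ = (-1) ^ n * ⟪a 0, b (m + n)⟫_ℂ := by
    intro n
    induction n with
    | zero => simp
    | succ n ih =>
      intro m
      rw [inner_infinitesimalGenerator hu (ha n) (hb m), ih, pow_succ, add_assoc, add_comm 1 n]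
      ring
  have h2 := (innerSL ℂ q.1).hasSum has
  have h3 := (innerSL ℂ p.1).hasSum hbs
  simp only [innerSL_apply_apply, inner_smul_right] at h2 h3
  have h4 := Complex.hasSum_conj'.2 h2
  rw [inner_conj_symm] at h4
  refine h4.unique ((congrArg (HasSum · _) (funext fun n ↦ ?_)).mpr h3)
  have h5 : ⟪a n, q.1⟫_ℂ = (-1) ^ n * ⟪p.1, b n⟫_ℂ := by simpa [ha0, hb0] using h1 n 0
  rw [map_mul, inner_conj_symm, h5, map_div₀, map_pow, map_mul, Complex.conj_ofReal,
    Complex.conj_I, Complex.conj_natCast, mul_neg, neg_pow]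
  have h6 : ((-1 : ℂ) ^ n) * (-1) ^ n = 1 := by rw [← mul_pow]; simp
  linear_combination ((c * Complex.I) ^ n / (n.factorial : ℂ) * ⟪p.1, b n⟫_ℂ) * h6

theorem inner_expGraph (hu : IsUnitaryOneParameterGroup u) {p q : H × H} (c : ℝ)
    (hp : p ∈ expGraph (infinitesimalGenerator u) (c * Complex.I))
    (hq : q ∈ expGraph (infinitesimalGenerator u) (c * Complex.I)) :
    ⟪p.2, q.1⟫_ℂ = ⟪p.1, q.2⟫_ℂ := by
  have h1 : ∀ q ∈ expSeriesGraph (infinitesimalGenerator u) (c * Complex.I),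
      ∀ p ∈ closure (expSeriesGraph (infinitesimalGenerator u) (c * Complex.I) : Set (H × H)),
      ⟪p.2, q.1⟫_ℂ = ⟪p.1, q.2⟫_ℂ := by
    intro q hq p hp
    refine closure_minimal (t := {p : H × H | ⟪p.2, q.1⟫_ℂ = ⟪p.1, q.2⟫_ℂ})
      (fun p hp ↦ inner_expSeriesGraph hu c hp hq) (isClosed_eq (by fun_prop) (by fun_prop)) hp
  exact closure_minimal (t := {q : H × H | ⟪p.2, q.1⟫_ℂ = ⟪p.1, q.2⟫_ℂ})
    (fun q hq ↦ h1 q hq p hp) (isClosed_eq (by fun_prop) (by fun_prop)) hq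

theorem IsEntireOrbit.mem_expGraph [CompleteSpace H] {F : ℂ → H} (hF : IsEntireOrbit u F)
    (z w : ℂ) : (F z, F (z + w)) ∈ expGraph (infinitesimalGenerator u) w :=
  subset_closure (hF.mem_expSeriesGraph z w)

/-- The exponential `e^{icA}` of the generator `A` of a unitary one-parameter group is closable. -/
theorem eq_zero_of_mem_expGraph [CompleteSpace H] (hu : IsUnitaryOneParameterGroup u) {c : ℝ}
    {η : H} (hη : ((0 : H), η) ∈ expGraph (infinitesimalGenerator u) (c * Complex.I)) : η = 0 := by
  -- Pairing `(0, η)` with the graph points of smoothed vectors makes `η` orthogonal to its own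
  -- smoothings, hence to itself in the limit.
  have h1 : ∀ b > 0, ⟪η, gaussianOrbit u b η 0⟫_ℂ = 0 := fun b hb ↦ by
    simpa using inner_expGraph hu c hη
      ((isEntireOrbit_gaussianOrbit hu hb η).mem_expGraph 0 (c * Complex.I))
  let K : ClosedSubmodule ℝ H := ⟨(LinearMap.ker (innerSL ℂ η).toLinearMap).restrictScalars ℝ,
    (innerSL ℂ η).isClosed_ker⟩
  have h2 : η ∈ K := mem_of_gaussianOrbit_mem hu K h1
  exact inner_self_eq_zero.1 h2

/-! ### Fixed spaces of `J e^{πiA}`: standardness and rigidity. -/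

/-- `V` is the space of fixed points of `J e^{πiA}`, with `A` the generator of `u`. -/
def IsModularFixedSpace (J : H ≃ₗᵢ[ℝ] H) (u : ℝ → H ≃ₗᵢ[ℂ] H) (V : ClosedSubmodule ℝ H) : Prop :=
  ∀ ξ, ξ ∈ V ↔ (ξ, J ξ) ∈ expGraph (infinitesimalGenerator u) (Real.pi * Complex.I)

namespace ClosedSubmodule

theorem mem_mulI_iff {S : ClosedSubmodule ℝ H} {x : H} : x ∈ S.mulI ↔ Complex.I • x ∈ S := by
  rw [mem_mapEquiv_iff, scalarSMulCLE_symm_apply]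
  have : (Complex.UnitI⁻¹ • x : H) = -(Complex.I • x) := by
    simp [Units.smul_def]
  rw [this]
  exact S.toSubmodule.neg_mem_iff

theorem isSeparating_iff {S : ClosedSubmodule ℝ H} :
    S.IsSeparating ↔ ∀ x, x ∈ S → Complex.I • x ∈ S → x = 0 := by
  rw [IsSeparating, eq_bot_iff]
  refine forall_congr' fun x ↦ ?_
  rw [← mem_mulI_iff, ← and_imp]
  rfl

/-- The symplectic complement is `(iS)ᗮ` and its multiple by `i` is `Sᗮ`, for the real orthogonal
complement; they meet in `(S + iS)ᗮ`. -/
theorem IsCyclic.isSeparating_symplComp {S : ClosedSubmodule ℝ H} (hS : S.IsCyclic) :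
    S.symplComp.IsSeparating := by
  rw [IsCyclic] at hS
  rw [IsSeparating, mulI_symplComp, inf_orthogonal, mulI_mulI_eq, sup_comm, hS]
  simp

end ClosedSubmodule

variable {J : H ≃ₗᵢ[ℝ] H} {V : ClosedSubmodule ℝ H}

/-- Polarization: antilinearity of `J` interchanges the two terms containing `i`. -/
theorem IsCommutingConjugation.inner_map_map (hJ : IsCommutingConjugation J u) (x y : H) :
    ⟪J x, J y⟫_ℂ = ⟪y, x⟫_ℂ := by
  have h1 : Complex.I • J y = J (-Complex.I • y) := by simp [hJ.smul]
  have h2 : ‖x - Complex.I • y‖ = ‖y + Complex.I • x‖ := by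
    have : x - Complex.I • y = -Complex.I • (y + Complex.I • x) := by
      rw [smul_add, smul_smul, neg_mul, Complex.I_mul_I, neg_neg, one_smul, neg_smul]; abel
    rw [this, norm_smul]; simp
  have h3 : ‖x + Complex.I • y‖ = ‖y - Complex.I • x‖ := by
    have : x + Complex.I • y = Complex.I • (y - Complex.I • x) := by
      rw [smul_sub, smul_smul, Complex.I_mul_I, neg_one_smul]; abel
    rw [this, norm_smul]; simp
  rw [inner_eq_sum_norm_sq_div_four, inner_eq_sum_norm_sq_div_four]
  simp only [RCLike.I_to_complex]
  rw [h1, ← map_add, ← map_sub, ← map_add, ← map_sub]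
  simp only [LinearIsometryEquiv.norm_map, neg_smul, sub_neg_eq_add, ← sub_eq_add_neg]
  rw [h2, h3, add_comm x y, norm_sub_rev x y]

theorem IsCommutingConjugation.inner_left (hJ : IsCommutingConjugation J u) (x y : H) :
    ⟪J x, y⟫_ℂ = ⟪J y, x⟫_ℂ := by
  rw [← hJ.inner_map_map, hJ.involutive]

variable [CompleteSpace H]

/-- If `x` and `ix` are fixed, the complex-linear graph contains both `(x, Jx)` and `(x, -Jx)`,
hence `(0, 2Jx)`; closability gives `Jx = 0`. -/
theorem IsModularFixedSpace.isSeparating (hV : IsModularFixedSpace J u V)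
    (hu : IsUnitaryOneParameterGroup u) (hJ : IsCommutingConjugation J u) : V.IsSeparating := by
  refine ClosedSubmodule.isSeparating_iff.2 fun x hx hix ↦ ?_
  rw [hV] at hx hix
  set Γ := expGraph (infinitesimalGenerator u) (Real.pi * Complex.I)
  rw [hJ.smul, Complex.conj_I] at hix
  have h1 := Γ.toSubmodule.sub_mem hx (Γ.toSubmodule.smul_mem (-Complex.I) hix)
  have h2 : ((x, J x) - (-Complex.I) • (Complex.I • x, -Complex.I • J x) : H × H) =
      (0, (2 : ℂ) • J x) := by
    ext <;> simp [smul_smul, two_smul]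
  rw [h2] at h1
  simpa using eq_zero_of_mem_expGraph hu h1

/-- A smoothed vector is of the form `x + i y`, with `x` and `y` fixed by `J e^{πiA}`. -/
theorem IsModularFixedSpace.exists_gaussianOrbit_eq (hV : IsModularFixedSpace J u V)
    (hu : IsUnitaryOneParameterGroup u) (hJ : IsCommutingConjugation J u) {b : ℝ} (hb : 0 < b)
    (ξ : H) : ∃ x ∈ V, ∃ y ∈ V, gaussianOrbit u b ξ 0 = x + Complex.I • y := by
  set Γ := expGraph (infinitesimalGenerator u) (Real.pi * Complex.I) with hΓ
  set w : ℂ := Real.pi * Complex.I with hw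
  have hc2 : (starRingEnd ℂ) 2 = 2 := map_ofNat _ 2
  have hcw : (starRingEnd ℂ) w = -w := by simp [hw]
  have h1 : (gaussianOrbit u b ξ 0, gaussianOrbit u b ξ w) ∈ Γ := by
    simpa using (isEntireOrbit_gaussianOrbit hu hb ξ).mem_expGraph 0 w
  -- Let `S = J e^{πiA}` and `F` be the smoothed orbit of `ξ`. As `w` is purely imaginary, `S F(0) =
  -- J F(w)` is the smoothed orbit of `J ξ` at `-w`. The witnesses below are the real and imaginary
  -- parts `(F(0) + S F(0))/2` and `(F(0) - S F(0))/(2i)` for this antilinear involution.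
  have h2 : (gaussianOrbit u b (J ξ) (-w), gaussianOrbit u b (J ξ) 0) ∈ Γ := by
    simpa using (isEntireOrbit_gaussianOrbit hu hb (J ξ)).mem_expGraph (-w) w
  have e1 : J (gaussianOrbit u b ξ 0) = gaussianOrbit u b (J ξ) 0 := by
    simp [hJ.map_gaussianOrbit]
  have e2 : J (gaussianOrbit u b (J ξ) (-w)) = gaussianOrbit u b ξ w := by
    simp [hJ.map_gaussianOrbit, hJ.involutive, hcw]
  refine ⟨(2⁻¹ : ℂ) • (gaussianOrbit u b ξ 0 + gaussianOrbit u b (J ξ) (-w)), ?_,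
    (-(Complex.I / 2)) • (gaussianOrbit u b ξ 0 - gaussianOrbit u b (J ξ) (-w)), ?_, ?_⟩
  · rw [hV, hJ.smul, map_add, e1, e2]
    refine (congrArg (· ∈ Γ) ?_).mp (Γ.toSubmodule.smul_mem (2⁻¹ : ℂ) (Γ.toSubmodule.add_mem h1 h2))
    ext <;> simp [add_comm, hc2]
  · rw [hV, hJ.smul, map_sub, e1, e2]
    refine (congrArg (· ∈ Γ) ?_).mp
      (Γ.toSubmodule.smul_mem (-(Complex.I / 2)) (Γ.toSubmodule.sub_mem h1 h2))
    ext
    · simp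
    · simp only [map_neg, map_div₀, Complex.conj_I, hc2, Prod.smul_snd, Prod.snd_sub]
      module
  · rw [smul_smul]
    have : Complex.I * -(Complex.I / 2) = 2⁻¹ := by
      linear_combination (-1 / 2) * Complex.I_mul_I
    rw [this, ← smul_add, add_add_sub_cancel, ← two_smul ℂ, smul_smul]
    norm_num

theorem IsModularFixedSpace.isCyclic (hV : IsModularFixedSpace J u V)
    (hu : IsUnitaryOneParameterGroup u) (hJ : IsCommutingConjugation J u) : V.IsCyclic := by
  rw [ClosedSubmodule.IsCyclic, eq_top_iff]
  intro ξ _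
  refine mem_of_gaussianOrbit_mem hu _ fun b hb ↦ ?_
  obtain ⟨x, hx, y, hy, h⟩ := hV.exists_gaussianOrbit_eq hu hJ hb ξ
  rw [h]
  refine (V ⊔ V.mulI).toSubmodule.add_mem ((le_sup_left : V ≤ V ⊔ V.mulI) hx)
    ((le_sup_right : V.mulI ≤ V ⊔ V.mulI) (ClosedSubmodule.mem_mulI_iff.2 ?_))
  rw [smul_smul, Complex.I_mul_I, neg_one_smul]
  exact V.toSubmodule.neg_mem hy

theorem IsModularFixedSpace.eq_of_le_of_isSeparating (hV : IsModularFixedSpace J u V)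
    (hu : IsUnitaryOneParameterGroup u) (hJ : IsCommutingConjugation J u)
    {K : ClosedSubmodule ℝ H} (hK : K.IsSeparating) (hVK : V ≤ K)
    (hinv : ∀ t, ∀ ξ ∈ K, u t ξ ∈ K) : K = V := by
  refine le_antisymm (fun ξ hξ ↦ mem_of_gaussianOrbit_mem hu _ fun b hb ↦ ?_) hVK
  have h1 := gaussianOrbit_zero_mem hu hb K fun t ↦ hinv t ξ hξ
  obtain ⟨x, hx, y, hy, h⟩ := hV.exists_gaussianOrbit_eq hu hJ hb ξ
  have h2 : Complex.I • y ∈ K := by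
    have := K.toSubmodule.sub_mem h1 (hVK hx)
    rwa [h, add_sub_cancel_left] at this
  rw [h, ClosedSubmodule.isSeparating_iff.1 hK y (hVK hy) h2, smul_zero, add_zero]
  exact hx

/-- Duality reduces this to the separating case. Writing `'` for the symplectic complement, `JK'` is
separating, invariant, and contains `V`, so `JK' = V`. Then `V` pairs trivially with `K' = JV`, so
`V ≤ K'' = K`. -/
theorem IsModularFixedSpace.eq_of_le_of_isCyclic (hV : IsModularFixedSpace J u V)
    (hu : IsUnitaryOneParameterGroup u) (hJ : IsCommutingConjugation J u)
    {K : ClosedSubmodule ℝ H} (hK : K.IsCyclic) (hKV : K ≤ V)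
    (hinv : ∀ t, ∀ ξ ∈ K, u t ξ ∈ K) : K = V := by
  -- This says `V ≤ JV'`: symmetry of `e^{πiA}` gives `⟪Jy, x⟫ = ⟪y, Jx⟫`, while antiunitarity of
  -- `J` makes these complex conjugates.
  have hVJ : ∀ x ∈ V, ∀ y ∈ V, (⟪y, J x⟫_ℂ).im = 0 := by
    intro x hx y hy
    have h1 : ⟪J y, x⟫_ℂ = ⟪y, J x⟫_ℂ := inner_expGraph hu Real.pi ((hV y).1 hy) ((hV x).1 hx)
    have h2 : (starRingEnd ℂ) ⟪y, J x⟫_ℂ = ⟪y, J x⟫_ℂ := by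
      rw [inner_conj_symm, hJ.inner_left, h1]
    exact Complex.conj_eq_iff_im.1 h2
  let K' : ClosedSubmodule ℝ H := K.symplComp.mapEquiv J.toContinuousLinearEquiv
  have hmem : ∀ x, x ∈ K' ↔ ∀ y ∈ K, (⟪y, J x⟫_ℂ).im = 0 := by
    intro x
    have : J.symm x = J x := by rw [J.symm_apply_eq, hJ.involutive]
    rw [← this]
    exact (ClosedSubmodule.mem_mapEquiv_iff (s := K.symplComp) _ x).trans ClosedSubmodule.mem_symplComp_iff
  have huinv : ∀ t y x, ⟪y, u t x⟫_ℂ = ⟪u (-t) y, x⟫_ℂ := by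
    intro t y x
    rw [← (u (-t)).inner_map_map y, ← hu.add, neg_add_cancel, hu.zero]
  have hsep : K'.IsSeparating := by
    rw [ClosedSubmodule.isSeparating_iff]
    intro x hx hix
    rw [hmem] at hx hix
    have h1 := ClosedSubmodule.isSeparating_iff.1 hK.isSeparating_symplComp (J x)
      (ClosedSubmodule.mem_symplComp_iff.2 hx) (ClosedSubmodule.mem_symplComp_iff.2 fun y hy ↦ ?_)
    · simpa using h1
    · have h2 := hix y hy
      rwa [hJ.smul, Complex.conj_I, neg_smul, inner_neg_right, Complex.neg_im, neg_eq_zero] at h2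
  have hK' : K' = V := hV.eq_of_le_of_isSeparating hu hJ hsep
    (fun x hx ↦ (hmem x).2 fun y hy ↦ hVJ x hx y (hKV hy)) fun t x hx ↦ (hmem _).2 fun y hy ↦ by
      rw [hJ.commute, huinv]
      exact (hmem x).1 hx _ (hinv _ _ hy)
  refine le_antisymm hKV fun x hx ↦ ?_
  rw [← ClosedSubmodule.symplComp_symplComp_eq (S := K), ClosedSubmodule.mem_symplComp_iff]
  intro y hy
  have h1 : J y ∈ V := by
    rw [← hK', hmem, hJ.involutive]
    exact ClosedSubmodule.mem_symplComp_iff.1 hy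
  have h2 := hVJ _ h1 _ hx
  rw [hJ.involutive] at h2
  rw [← inner_conj_symm, Complex.conj_im, h2, neg_zero]

end OneParameterGroups

/-! ### Exponential curves as one-parameter subgroups. -/

section ExponentialCurves

variable {E : Type*} [NormedAddCommGroup E] [NormedSpace ℝ E] [FiniteDimensional ℝ E]
  {G : Type*} [TopologicalSpace G] [ChartedSpace E G] [Group G] [LieGroup 𝓘(ℝ, E) ∞ G]

theorem eq_of_isMIntegralCurve_mulInvariantVectorField [T2Space G]
    {x : GroupLieAlgebra 𝓘(ℝ, E) G} {γ γ' : ℝ → G}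
    (hγ : IsMIntegralCurve γ (mulInvariantVectorField (I := 𝓘(ℝ, E)) x))
    (hγ' : IsMIntegralCurve γ' (mulInvariantVectorField (I := 𝓘(ℝ, E)) x)) (h : γ 0 = γ' 0) :
    γ = γ' := by
  have hsm : minSmoothness ℝ 2 = 2 := minSmoothness_of_isRCLikeNormedField
  have : IsManifold 𝓘(ℝ, E) ∞ G := (inferInstance : LieGroup 𝓘(ℝ, E) ∞ G).toIsManifold
  have : IsManifold 𝓘(ℝ, E) 1 G := IsManifold.of_le (n := ∞) (by exact_mod_cast le_top)
  have : CompleteSpace E := FiniteDimensional.complete ℝ E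
  refine isMIntegralCurve_Ioo_eq_of_contMDiff_boundaryless ?_ hγ hγ' h
  refine (contMDiff_mulInvariantVectorField x).of_le ?_
  rw [hsm]; exact_mod_cast one_le_two

/-- A differentiable map `f` with `f (g * k) = f g * ρ k`, for a map `ρ` with `ρ 1 = 1` and
`dρ x = x`, carries integral curves of the left-invariant field of `x` to integral curves. -/
theorem IsMIntegralCurve.comp_mulInvariantVectorField
    {x : GroupLieAlgebra 𝓘(ℝ, E) G} {γ : ℝ → G} {f : G → G}
    (hγ : IsMIntegralCurve γ (mulInvariantVectorField (I := 𝓘(ℝ, E)) x))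
    (hf : MDifferentiable 𝓘(ℝ, E) 𝓘(ℝ, E) f) {ρ : G → G}
    (hρ : MDifferentiableAt 𝓘(ℝ, E) 𝓘(ℝ, E) ρ 1) (hρ1 : ρ 1 = 1)
    (hρx : mfderiv 𝓘(ℝ, E) 𝓘(ℝ, E) ρ 1 x = (x : E))
    (hmul : ∀ g k, f (g * k) = f g * ρ k) :
    IsMIntegralCurve (f ∘ γ) (mulInvariantVectorField (I := 𝓘(ℝ, E)) x) := by
  have hd : ∀ a b : G, MDifferentiableAt 𝓘(ℝ, E) 𝓘(ℝ, E) (fun c : G ↦ a * c) b := fun a b ↦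
    (contMDiff_mul_left (n := ∞)).mdifferentiableAt (by simp)
  intro t
  have key : mulInvariantVectorField (I := 𝓘(ℝ, E)) x (f (γ t)) =
      mfderiv 𝓘(ℝ, E) 𝓘(ℝ, E) f (γ t) (mulInvariantVectorField x (γ t)) := by
    have hcomp : f ∘ (fun c : G ↦ γ t * c) = (fun c : G ↦ f (γ t) * c) ∘ ρ :=
      funext fun c ↦ hmul _ _
    have h1 := mfderiv_comp (I' := 𝓘(ℝ, E)) (1 : G) (hf (γ t * 1)) (hd (γ t) 1)
    have h2 := mfderiv_comp (I' := 𝓘(ℝ, E)) (1 : G) (hd (f (γ t)) (ρ 1)) hρ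
    have h3 : mfderiv 𝓘(ℝ, E) 𝓘(ℝ, E) f (γ t * 1)
          (mfderiv 𝓘(ℝ, E) 𝓘(ℝ, E) (fun c : G ↦ γ t * c) 1 x) =
        mfderiv 𝓘(ℝ, E) 𝓘(ℝ, E) (fun c : G ↦ f (γ t) * c) (ρ 1)
          (mfderiv 𝓘(ℝ, E) 𝓘(ℝ, E) ρ 1 x) := by
      rw [hcomp, h2] at h1
      exact congrArg (fun L : E →L[ℝ] E ↦ L x) h1.symm
    -- The base points `γ t * 1` and `γ t`, and likewise `ρ 1` and `1`, agree only propositionally;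
    -- viewing all tangent vectors in `E` allows the transport.
    have h4 : ∀ (φ : G → G) (a b : G) (v : E), a = b →
        (mfderiv 𝓘(ℝ, E) 𝓘(ℝ, E) φ a v : E) = (mfderiv 𝓘(ℝ, E) 𝓘(ℝ, E) φ b v : E) := by
      rintro φ a _ v rfl; rfl
    have h5 := h4 f _ _ (mfderiv 𝓘(ℝ, E) 𝓘(ℝ, E) (fun c : G ↦ γ t * c) 1 x) (mul_one (γ t))
    have h6 := h4 (fun c : G ↦ f (γ t) * c) _ _ x hρ1
    exact (h6.symm.trans (congrArg _ hρx.symm)).trans (h3.symm.trans h5)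
  refine (HasMFDerivAt.comp t (hf (γ t)).hasMFDerivAt (hγ t)).congr_mfderiv ?_
  refine ContinuousLinearMap.ext_ring ?_
  change mfderiv 𝓘(ℝ, E) 𝓘(ℝ, E) f (γ t)
    ((1 : ℝ) • mulInvariantVectorField x (γ t)) = (1 : ℝ) • mulInvariantVectorField x (f (γ t))
  rw [one_smul, one_smul, key]

variable [T2Space G]

theorem expCurve_zero (x : GroupLieAlgebra 𝓘(ℝ, E) G) : expCurve x 0 = 1 :=
  (exists_expCurve x).choose_spec.1

theorem isMIntegralCurve_expCurve (x : GroupLieAlgebra 𝓘(ℝ, E) G) :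
    IsMIntegralCurve (expCurve x) (mulInvariantVectorField (I := 𝓘(ℝ, E)) x) :=
  (exists_expCurve x).choose_spec.2

theorem continuous_expCurve (x : GroupLieAlgebra 𝓘(ℝ, E) G) : Continuous (expCurve x) :=
  (isMIntegralCurve_expCurve x).continuous

/-- Both sides are integral curves in `t` of the same left-invariant field with the same initial
value. -/
theorem expCurve_add (x : GroupLieAlgebra 𝓘(ℝ, E) G) (s t : ℝ) :
    expCurve x (s + t) = expCurve x s * expCurve x t := by
  have h1 : IsMIntegralCurve ((fun c ↦ expCurve x s * c) ∘ expCurve x)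
      (mulInvariantVectorField (I := 𝓘(ℝ, E)) x) :=
    (isMIntegralCurve_expCurve x).comp_mulInvariantVectorField (ρ := id)
      ((contMDiff_mul_left (n := ∞)).mdifferentiable (by simp)) mdifferentiableAt_id rfl
      (by rw [mfderiv_id]; rfl) fun g k ↦ (mul_assoc _ _ _).symm
  have h2 := eq_of_isMIntegralCurve_mulInvariantVectorField
    ((isMIntegralCurve_expCurve x).comp_add s) h1 (by simp [expCurve_zero])
  rw [add_comm]
  exact congrFun h2 t

theorem IsEulerInvolution.map_expCurve {h : GroupLieAlgebra 𝓘(ℝ, E) G} {τ : MulAut G}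
    (hτ : IsEulerInvolution h τ) (t : ℝ) : τ (expCurve h t) = expCurve h t := by
  have hd : MDifferentiable 𝓘(ℝ, E) 𝓘(ℝ, E) τ := hτ.smooth.mdifferentiable (by simp)
  have h0 : mfderiv 𝓘(ℝ, E) 𝓘(ℝ, E) τ 1 h = (h : E) := by
    -- Since `⁅h, h⁆ = 0`, the element `h` is an eigenvector for `n = 0` and is fixed by the
    -- differential of `τ`.
    have := hτ.differential 0 h (by simp)
    simpa using this
  have h1 := (isMIntegralCurve_expCurve h).comp_mulInvariantVectorField (ρ := τ) hd (hd 1)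
    (map_one τ) h0 (map_mul τ)
  exact congrFun (eq_of_isMIntegralCurve_mulInvariantVectorField h1 (isMIntegralCurve_expCurve h)
    (by simp [expCurve_zero])) t

end ExponentialCurves

/-! ### Modular data of an antiunitary representation. -/

section Representations

variable {G : Type*} [Group G] [TopologicalSpace G] {τ : MulAut G}
  {H : Type*} [NormedAddCommGroup H] [InnerProductSpace ℂ H]

theorem AntiunitaryRep.U_one (U : AntiunitaryRep τ H) (ξ : H) : U.U 1 ξ = ξ := by
  change (U.toHom (SemidirectProduct.inl 1)).1 ξ = ξ
  rw [map_one, map_one]; rfl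

theorem AntiunitaryRep.U_mul (U : AntiunitaryRep τ H) (g g' : G) (ξ : H) :
    U.U (g * g') ξ = U.U g (U.U g' ξ) := by
  change (U.toHom (SemidirectProduct.inl (g * g'))).1 ξ = _
  rw [map_mul, map_mul]; rfl

theorem AntiunitaryRep.J_U (U : AntiunitaryRep τ H) (g : G) (ξ : H) :
    U.J (U.U g ξ) = U.U (τ g) (U.J ξ) := by
  -- In the semidirect product, conjugation by `τ` on the copy of `G` is the automorphism `τ`.
  have h1 := SemidirectProduct.inl_aut (φ := (Subgroup.zpowers τ).subtype)
    ⟨τ, Subgroup.mem_zpowers τ⟩ g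
  rw [map_inv, eq_mul_inv_iff_mul_eq] at h1
  have h2 := congrArg (fun T ↦ (U.toHom T).1 ξ) h1
  simp only [map_mul] at h2
  exact h2.symm

theorem AntiunitaryRep.J_J (U : AntiunitaryRep τ H) (hτ : τ * τ = 1) (ξ : H) :
    U.J (U.J ξ) = ξ := by
  have h1 : (⟨τ, Subgroup.mem_zpowers τ⟩ : Subgroup.zpowers τ) * ⟨τ, Subgroup.mem_zpowers τ⟩ = 1 :=
    Subtype.ext hτ
  have h2 := congrArg (fun T ↦ (U.toHom (SemidirectProduct.inr T)).1 ξ) h1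
  simp only [map_mul, map_one] at h2
  exact h2

variable {E : Type*} [NormedAddCommGroup E] [NormedSpace ℝ E] [FiniteDimensional ℝ E]
  [ChartedSpace E G] [LieGroup 𝓘(ℝ, E) ∞ G] [T2Space G]

theorem AntiunitaryRep.isUnitaryOneParameterGroup (U : AntiunitaryRep τ H)
    (h : GroupLieAlgebra 𝓘(ℝ, E) G) :
    IsUnitaryOneParameterGroup fun t ↦ U.U (expCurve h t) where
  zero ξ := by rw [expCurve_zero, U.U_one]
  add s t ξ := by rw [expCurve_add, U.U_mul]
  continuous ξ := (U.continuous ξ).comp (continuous_expCurve h)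

theorem AntiunitaryRep.isCommutingConjugation (U : AntiunitaryRep τ H)
    {h : GroupLieAlgebra 𝓘(ℝ, E) G} (hτ : IsEulerInvolution h τ) :
    IsCommutingConjugation U.J fun t ↦ U.U (expCurve h t) where
  smul := U.antiunitary
  involutive := U.J_J hτ.involutive
  commute t ξ := by rw [U.J_U, hτ.map_expCurve]

theorem isModularFixedSpace_canonicalSubspace (U : AntiunitaryRep τ H)
    {h : GroupLieAlgebra 𝓘(ℝ, E) G} (hτ : IsEulerInvolution h τ) :
    IsModularFixedSpace U.J (fun t ↦ U.U (expCurve h t)) (canonicalSubspace h U) := by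
  intro ξ
  have hJ := U.J_J hτ.involutive
  constructor
  · rintro ⟨η, h1, rfl⟩
    rw [hJ]
    exact h1
  · exact fun h1 ↦ ⟨_, h1, hJ ξ⟩

end Representations

/-! ### Isotony, covariance and the values of the nets at `W`. -/

section Nets

variable {G : Type*} [Group G] [TopologicalSpace G] {τ : MulAut G}
  {H : Type*} [NormedAddCommGroup H] [InnerProductSpace ℂ H]

namespace ClosedSubmodule

theorem mem_image_iff {T : H ≃ₗᵢ[ℂ] H} {S : ClosedSubmodule ℝ H} {x : H} :
    x ∈ S.image T ↔ T.symm x ∈ S :=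
  mem_mapEquiv_iff (s := S) (T.toContinuousLinearEquiv.restrictScalars ℝ) x

theorem image_mem_image {T : H ≃ₗᵢ[ℂ] H} {S : ClosedSubmodule ℝ H} {x : H} (hx : x ∈ S) :
    T x ∈ S.image T := by
  rw [mem_image_iff, T.symm_apply_apply]; exact hx

theorem image_mono {T : H ≃ₗᵢ[ℂ] H} {S S' : ClosedSubmodule ℝ H} (h : S ≤ S') :
    S.image T ≤ S'.image T := fun _ hx ↦ mem_image_iff.2 (h (mem_image_iff.1 hx))

theorem image_mulI (T : H ≃ₗᵢ[ℂ] H) (S : ClosedSubmodule ℝ H) :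
    S.mulI.image T = (S.image T).mulI := by
  refine SetLike.ext fun x ↦ ?_
  rw [mem_image_iff, mem_mulI_iff, mem_mulI_iff, mem_image_iff, map_smul]

theorem IsCyclic.image {S : ClosedSubmodule ℝ H} (hS : S.IsCyclic) (T : H ≃ₗᵢ[ℂ] H) :
    (S.image T).IsCyclic := by
  rw [IsCyclic] at hS ⊢
  rw [← image_mulI]
  refine (mapEquiv_sup_eq _).symm.trans ?_
  rw [hS]
  exact mapEquiv_top_eq_top _

end ClosedSubmodule

theorem AntiunitaryRep.image_one (U : AntiunitaryRep τ H) (S : ClosedSubmodule ℝ H) :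
    S.image (U.U 1) = S := by
  refine SetLike.ext fun x ↦ ?_
  rw [ClosedSubmodule.mem_image_iff]
  conv_lhs => rw [← U.U_one x, LinearIsometryEquiv.symm_apply_apply]

theorem AntiunitaryRep.image_mul (U : AntiunitaryRep τ H) (g g' : G) (S : ClosedSubmodule ℝ H) :
    S.image (U.U (g * g')) = (S.image (U.U g')).image (U.U g) := by
  refine SetLike.ext fun x ↦ ?_
  simp only [ClosedSubmodule.mem_image_iff]
  have : (U.U (g * g')).symm x = (U.U g').symm ((U.U g).symm x) := by
    rw [LinearIsometryEquiv.symm_apply_eq, U.U_mul]; simp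
  rw [this]

theorem AntiunitaryRep.image_le_iff (U : AntiunitaryRep τ H) (g : G) (S T : ClosedSubmodule ℝ H) :
    S.image (U.U g) ≤ T ↔ S ≤ T.image (U.U g⁻¹) := by
  constructor <;> intro h
  · have := ClosedSubmodule.image_mono (T := U.U g⁻¹) h
    rwa [← U.image_mul, inv_mul_cancel, U.image_one] at this
  · have := ClosedSubmodule.image_mono (T := U.U g) h
    rwa [← U.image_mul, mul_inv_cancel, U.image_one] at this

variable [IsTopologicalGroup G] {L : Subgroup G}

theorem translateOpens_mono {g : G} {O O' : Opens (G ⧸ L)} (h : O ≤ O') :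
    translateOpens g O ≤ translateOpens g O' :=
  Set.smul_set_mono (show (O : Set (G ⧸ L)) ⊆ O' from h)

theorem translateOpens_one (O : Opens (G ⧸ L)) : translateOpens 1 O = O :=
  Opens.ext (one_smul G (O : Set (G ⧸ L)))

theorem translateOpens_mul (g g' : G) (O : Opens (G ⧸ L)) :
    translateOpens (g * g') O = translateOpens g (translateOpens g' O) :=
  Opens.ext (mul_smul g g' (O : Set (G ⧸ L)))

theorem translateOpens_le_iff {g : G} {O O' : Opens (G ⧸ L)} :
    translateOpens g O ≤ O' ↔ O ≤ translateOpens g⁻¹ O' := by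
  constructor <;> intro h
  · have := translateOpens_mono (g := g⁻¹) h
    rwa [← translateOpens_mul, inv_mul_cancel, translateOpens_one] at this
  · have := translateOpens_mono (g := g) h
    rwa [← translateOpens_mul, mul_inv_cancel, translateOpens_one] at this

variable {U : AntiunitaryRep τ H} {V : ClosedSubmodule ℝ H} {W : Opens (G ⧸ L)}

theorem le_maxNet_iff {S : ClosedSubmodule ℝ H} {O : Opens (G ⧸ L)} :
    S ≤ maxNet U V W O ↔ ∀ g, O ≤ translateOpens g W → S ≤ V.image (U.U g) := by
  constructor
  · exact fun h g hg x hx ↦ ClosedSubmodule.mem_iInf.1 (h hx) ⟨g, hg⟩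
  · exact fun h x hx ↦ ClosedSubmodule.mem_iInf.2 fun g ↦ h g.1 g.2 hx

theorem minNet_le_iff {S : ClosedSubmodule ℝ H} {O : Opens (G ⧸ L)} :
    minNet U V W O ≤ S ↔ ∀ g, translateOpens g W ≤ O → V.image (U.U g) ≤ S := by
  unfold minNet
  rw [iSup_le_iff, Subtype.forall]

theorem isIsotone_maxNet (U : AntiunitaryRep τ H) (V : ClosedSubmodule ℝ H) (W : Opens (G ⧸ L)) :
    IsIsotone (maxNet U V W) := fun _ _ h ↦
  le_maxNet_iff.2 fun g hg ↦ le_maxNet_iff.1 le_rfl g (h.trans hg)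

theorem isIsotone_minNet (U : AntiunitaryRep τ H) (V : ClosedSubmodule ℝ H) (W : Opens (G ⧸ L)) :
    IsIsotone (minNet U V W) := fun _ _ h ↦
  minNet_le_iff.2 fun g hg ↦ minNet_le_iff.1 le_rfl g (hg.trans h)

/-- A net is covariant as soon as `U(g) N(O) ⊆ N(gO)`. -/
theorem isCovariant_of_image_le {N : Opens (G ⧸ L) → ClosedSubmodule ℝ H}
    (h : ∀ g O, (N O).image (U.U g) ≤ N (translateOpens g O)) : IsCovariant U N := by
  refine fun g O ↦ le_antisymm (h g O) ?_
  have h1 := ClosedSubmodule.image_mono (T := U.U g) (h g⁻¹ (translateOpens g O))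
  rwa [← U.image_mul, mul_inv_cancel, U.image_one, ← translateOpens_mul, inv_mul_cancel,
    translateOpens_one] at h1

theorem isCovariant_maxNet (U : AntiunitaryRep τ H) (V : ClosedSubmodule ℝ H) (W : Opens (G ⧸ L)) :
    IsCovariant U (maxNet U V W) := by
  refine isCovariant_of_image_le fun g O ↦ le_maxNet_iff.2 fun g' hg' ↦ ?_
  rw [U.image_le_iff, ← U.image_mul]
  refine le_maxNet_iff.1 le_rfl _ ?_
  rwa [translateOpens_mul, ← translateOpens_le_iff]

theorem isCovariant_minNet (U : AntiunitaryRep τ H) (V : ClosedSubmodule ℝ H) (W : Opens (G ⧸ L)) :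
    IsCovariant U (minNet U V W) := by
  refine isCovariant_of_image_le fun g O ↦ ?_
  rw [U.image_le_iff, minNet_le_iff]
  intro g' hg'
  rw [← U.image_le_iff, ← U.image_mul]
  refine minNet_le_iff.1 le_rfl _ ?_
  rw [translateOpens_mul]
  exact translateOpens_mono hg'

theorem maxNet_self_le : maxNet U V W W ≤ V := by
  have := le_maxNet_iff.1 (le_refl (maxNet U V W W)) 1 (translateOpens_one W).ge
  rwa [U.image_one] at this

theorem le_minNet_self : V ≤ minNet U V W W := by
  have := minNet_le_iff.1 (le_refl (minNet U V W W)) 1 (translateOpens_one W).le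
  rwa [U.image_one] at this

/-- Inversion matches the conditions: `W ⊆ gW` means `g⁻¹ ∈ S_W`, and `V ⊆ U(g)V` means `g⁻¹ ∈ S_V`.
-/
theorem maxNet_self_eq_iff :
    maxNet U V W W = V ↔ compressionSemigroup W ⊆ endomorphismSemigroup U V := by
  constructor
  · intro h g hg
    have := le_maxNet_iff.1 h.ge g⁻¹ (translateOpens_le_iff.1 hg)
    exact (U.image_le_iff _ _ _).2 this
  · refine fun h ↦ le_antisymm maxNet_self_le (le_maxNet_iff.2 fun g hg ↦ ?_)
    have h1 : g⁻¹ ∈ compressionSemigroup W :=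
      translateOpens_le_iff.2 (by rwa [inv_inv])
    have h2 := (U.image_le_iff _ _ _).1 (h h1)
    rwa [inv_inv] at h2

theorem minNet_self_eq_iff :
    minNet U V W W = V ↔ compressionSemigroup W ⊆ endomorphismSemigroup U V :=
  ⟨fun h _ hg ↦ minNet_le_iff.1 h.le _ hg,
    fun h ↦ le_antisymm (minNet_le_iff.2 fun _ hg ↦ h hg) le_minNet_self⟩

theorem IsCovariant.map_mem {N : Opens (G ⧸ L) → ClosedSubmodule ℝ H} (hN : IsCovariant U N) {g : G}
    {O : Opens (G ⧸ L)} (hg : translateOpens g O = O) {ξ : H} (hξ : ξ ∈ N O) : U.U g ξ ∈ N O := by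
  have := ClosedSubmodule.image_mem_image (T := U.U g) hξ
  rwa [hN, hg] at this

end Nets

/-! ### Assembly of the theorem. -/

theorem mainTheorem4
    {E : Type*} [NormedAddCommGroup E] [NormedSpace ℝ E] [FiniteDimensional ℝ E]
    {G : Type*} [TopologicalSpace G] [ChartedSpace E G] [Group G] [LieGroup 𝓘(ℝ, E) ∞ G]
    [IsTopologicalGroup G] [T2Space G] [ConnectedSpace G]
    (h : GroupLieAlgebra 𝓘(ℝ, E) G) (hh : IsEulerElement h)
    (τ : MulAut G) (hτ : IsEulerInvolution h τ)
    {H : Type*} [NormedAddCommGroup H] [InnerProductSpace ℂ H] [CompleteSpace H]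
    (U : AntiunitaryRep τ H)
    (L : Subgroup G) (hL : IsClosed (L : Set G))
    (W : Opens (G ⧸ L)) (hW : (W : Set (G ⧸ L)).Nonempty)
    (hWinv : ∀ t : ℝ, translateOpens (expCurve h t) W = W) :
    IsIsotone (maxNet U (canonicalSubspace h U) W) ∧
    IsCovariant U (maxNet U (canonicalSubspace h U) W) ∧
    IsIsotone (minNet U (canonicalSubspace h U) W) ∧
    IsCovariant U (minNet U (canonicalSubspace h U) W) ∧
    (∀ (g : G) (O : Opens (G ⧸ L)), (maxNet U (canonicalSubspace h U) W O).IsCyclic →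
      (maxNet U (canonicalSubspace h U) W (translateOpens g O)).IsCyclic) ∧
    List.TFAE [
      compressionSemigroup W ⊆ endomorphismSemigroup U (canonicalSubspace h U),
      maxNet U (canonicalSubspace h U) W W = canonicalSubspace h U,
      (maxNet U (canonicalSubspace h U) W W).IsStandard,
      (maxNet U (canonicalSubspace h U) W W).IsCyclic,
      minNet U (canonicalSubspace h U) W W = canonicalSubspace h U,
      (minNet U (canonicalSubspace h U) W W).IsStandard,
      (minNet U (canonicalSubspace h U) W W).IsSeparating] := by
  have hu := U.isUnitaryOneParameterGroup h
  have hJ := U.isCommutingConjugation hτ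
  have hV := isModularFixedSpace_canonicalSubspace U hτ
  have hmax := isCovariant_maxNet U (canonicalSubspace h U) W
  have hmin := isCovariant_minNet U (canonicalSubspace h U) W
  have hstd : (canonicalSubspace h U).IsStandard := ⟨hV.isCyclic hu hJ, hV.isSeparating hu hJ⟩
  refine ⟨isIsotone_maxNet _ _ _, hmax, isIsotone_minNet _ _ _, hmin,
    fun g O hO ↦ hmax g O ▸ hO.image (U.U g), ?_⟩
  tfae_have 1 ↔ 2 := maxNet_self_eq_iff.symm
  tfae_have 2 → 3 := fun h2 ↦ h2.symm ▸ hstd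
  tfae_have 3 → 4 := And.left
  -- Covariance and `exp(th)W = W` supply the modular invariance required for rigidity, here and in
  -- `7 → 5`.
  tfae_have 4 → 2 := fun h4 ↦ hV.eq_of_le_of_isCyclic hu hJ h4 maxNet_self_le
    fun t _ hξ ↦ hmax.map_mem (hWinv t) hξ
  tfae_have 1 ↔ 5 := minNet_self_eq_iff.symm
  tfae_have 5 → 6 := fun h5 ↦ h5.symm ▸ hstd
  tfae_have 6 → 7 := And.right
  tfae_have 7 → 5 := fun h7 ↦ hV.eq_of_le_of_isSeparating hu hJ h7 le_minNet_self
    fun t _ hξ ↦ hmin.map_mem (hWinv t) hξ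
  tfae_finish
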